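/- Let $(\Omega,\mu)$ be a finite measure space and let $T:\Omega\to\Omega$ be an ergodic measure-preserving transformation (not assumed invertible). Let a.u. $WW(\Omega,T)$ denote the set of all ($\mu$-a.e. defined) measurable functions $f:\Omega\to\mathbb C$ with the following property: for every $\varepsilon>0$ there is a measurable set $\Omega'\subset\Omega$ with $\mu(\Omega\setminus\Omega')\le\varepsilon$ such that, for every $\lambda\in\mathbb C$ with $|\lambda|=1$, the averages $$M_n(T,\lambda)(f)=\frac1n\sum_{k=0}^{n-1}\lambda^k\, f\circ T^k$$ converge uniformly on $\Omega'$ as $n\to\infty$ (the set $\Omega'$ depends on $f$ and $\varepsilon$, but not on $\lambda$). Then $L^1(\Omega,\mu)\subset$ a.u. $WW(\Omega,T)$. -/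

import Mathlib

open MeasureTheory Filter

namespace WienerWintner

/-- The weighted ergodic average `M_n(T, z)(f) = (1/n) ∑_{k=0}^{n-1} z^k f ∘ T^k`
(for `n = 0` its value is `0`, which plays no role in limits as `n → ∞`). -/
noncomputable def average {Ω : Type*} (T : Ω → Ω) (z : ℂ) (n : ℕ) (f : Ω → ℂ) : Ω → ℂ :=
  fun ω => (1 / (n : ℂ)) * ∑ k ∈ Finset.range n, z ^ k * f (T^[k] ω)

/-- The class `a.u. WW(Ω, T)`: the measurable functions `f` (modulo null sets) such that for every
`ε > 0` there is a measurable set `A` with `μ (Ω \ A) ≤ ε` on which, for every complex number `z`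
of modulus one, the averages `M_n(T, z)(f)` converge uniformly. The set `A` does not depend
on `z`. -/
def auWW {Ω : Type*} [MeasurableSpace Ω] (μ : Measure Ω) (T : Ω → Ω) : Set (Ω → ℂ) :=
  {f | AEStronglyMeasurable f μ ∧
    ∀ ε : ℝ, 0 < ε → ∃ A : Set Ω, MeasurableSet A ∧ μ Aᶜ ≤ ENNReal.ofReal ε ∧
      ∀ z : ℂ, ‖z‖ = 1 →
        ∃ g : Ω → ℂ, TendstoUniformlyOn (fun n : ℕ => average T z n f) g atTop A}

end WienerWintner

/-! The functions whose weighted averages are almost uniformly Cauchy (`AlmostUniformCauchy`) form a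
vector space. It is closed under `L¹` limits, because the weak type `(1,1)` inequality bounds the
averages of `|f - g|`, and these dominate the averages of `f - g` for every weight at once
(`AlmostUniformCauchy.of_approx`). It therefore suffices to treat a dense part of `L²`.

Let `f ∈ L²` be orthogonal to this space. Project `F(x, y) = f(x) conj(f(y))` onto the `T ×
T`-invariant functions to get a kernel `K`. Kernel operators turn `L²` convergence of averages into
almost uniform convergence, so `g = ∫ K(·, y) f(y)` lies in the space. Hence `‖K‖² = ⟨K, F⟩` is the
conjugate of `⟨f, g⟩ = 0`. Thus `K = 0`, which says that the squared autocorrelations of `f` vanish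
on average (`tendsto_autocorrelation`).

Van der Corput's inequality bounds the averages of `f` by correlations along the orbit that do not
involve the weight. Birkhoff's theorem evaluates these almost everywhere, and Egorov's theorem makes
the bound uniform off a small set (`almostUniformCauchy_of_tendsto_autocorrelation`). So `f` itself
lies in the space, hence `f = 0`, and the space is dense in `L²`. -/

namespace WienerWintner

open scoped Topology

/-! ### Maximal ergodic inequality. -/

section Maximal

variable {Ω : Type*}

/-- The running maximum `max_{k ≤ n} ∑_{i < k} h ∘ T^i`, in recursive form. -/
noncomputable def maximalSum (T : Ω → Ω) (h : Ω → ℝ) : ℕ → Ω → ℝ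
  | 0 => fun _ => 0
  | n + 1 => fun x => max 0 (h x + maximalSum T h n (T x))

lemma maximalSum_nonneg (T : Ω → Ω) (h : Ω → ℝ) (n : ℕ) (x : Ω) : 0 ≤ maximalSum T h n x := by
  cases n with
  | zero => exact le_rfl
  | succ n => exact le_max_left _ _

lemma maximalSum_le_succ (T : Ω → Ω) (h : Ω → ℝ) (n : ℕ) :
    ∀ x, maximalSum T h n x ≤ maximalSum T h (n + 1) x := by
  induction n with
  | zero => exact fun x => maximalSum_nonneg T h 1 x
  | succ n ih =>
    intro x
    exact max_le_max le_rfl (add_le_add le_rfl (ih (T x)))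

lemma sum_iterate_le_maximalSum (T : Ω → Ω) (h : Ω → ℝ) (n : ℕ) :
    ∀ x, ∑ k ∈ Finset.range n, h (T^[k] x) ≤ maximalSum T h n x := by
  induction n with
  | zero => intro x; simp [maximalSum]
  | succ n ih =>
    intro x
    rw [Finset.sum_range_succ', add_comm]
    simp only [Function.iterate_succ_apply, Function.iterate_zero_apply]
    exact (add_le_add le_rfl (ih (T x))).trans (le_max_right _ _)

variable [MeasurableSpace Ω] {μ : Measure Ω} {T : Ω → Ω}

lemma integrable_maximalSum (hT : MeasurePreserving T μ μ) {h : Ω → ℝ} (hh : Integrable h μ)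
    (n : ℕ) : Integrable (maximalSum T h n) μ := by
  induction n with
  | zero => exact integrable_zero _ _ _
  | succ n ih =>
    exact (integrable_zero _ _ _).sup (hh.add ((hT.integrable_comp_of_integrable ih)))

/-- The maximal ergodic theorem for finitely many averages. -/
lemma setIntegral_maximalSum_pos_nonneg (hT : MeasurePreserving T μ μ) {h : Ω → ℝ}
    (hh : Integrable h μ) (n : ℕ) :
    0 ≤ ∫ x in {x | 0 < maximalSum T h n x}, h x ∂μ := by
  have hM := integrable_maximalSum hT hh n
  have hMT : Integrable (fun x => maximalSum T h n (T x)) μ := hT.integrable_comp_of_integrable hM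
  have hE : NullMeasurableSet {x | 0 < maximalSum T h n x} μ :=
    nullMeasurableSet_lt aemeasurable_const hM.aemeasurable
  -- Garsia's argument: where the maximum is positive it equals `h` plus an earlier maximum at `T
  -- x`; elsewhere it is `0`. The left side has integral zero by invariance of `μ`.
  have key : ∀ x, maximalSum T h n x - maximalSum T h n (T x) ≤
      Set.indicator {x | 0 < maximalSum T h n x} h x := by
    intro x
    by_cases hx : 0 < maximalSum T h n x
    · rw [Set.indicator_of_mem (by exact hx)]
      cases n with
      | zero => simp [maximalSum] at hx
      | succ n =>
        have h1 : maximalSum T h (n + 1) x = h x + maximalSum T h n (T x) := by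
          rcases max_cases 0 (h x + maximalSum T h n (T x)) with h2 | h2
          · exact absurd (h2.1 ▸ hx : 0 < (0 : ℝ)) (lt_irrefl _)
          · exact h2.1
        have := maximalSum_le_succ T h n (T x)
        linarith
    · rw [Set.indicator_of_notMem (by exact hx)]
      have := maximalSum_nonneg T h n (T x)
      linarith [not_lt.1 hx]
  have h0 : ∫ x, (maximalSum T h n x - maximalSum T h n (T x)) ∂μ = 0 := by
    rw [integral_sub hM hMT, sub_eq_zero]
    conv_lhs => rw [← hT.map_eq]
    exact integral_map hT.aemeasurable (by rw [hT.map_eq]; exact hM.aestronglyMeasurable)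
  rw [← integral_indicator₀ hE]
  exact h0.symm.le.trans (integral_mono (hM.sub hMT) (hh.indicator₀ hE) key)

/-- The weak type `(1,1)` maximal inequality for ergodic averages. -/
lemma exists_forall_sum_norm_iterate_le [IsFiniteMeasure μ] (hT : MeasurePreserving T μ μ)
    {f : Ω → ℂ} (hf : Integrable f μ) {t : ℝ} (ht : 0 < t) :
    ∃ A : Set Ω, MeasurableSet A ∧ μ Aᶜ ≤ ENNReal.ofReal ((∫ x, ‖f x‖ ∂μ) / t) ∧
      ∀ x ∈ A, ∀ n : ℕ, ∑ k ∈ Finset.range n, ‖f (T^[k] x)‖ ≤ n * t := by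
  set h : Ω → ℝ := fun x => ‖f x‖ - t with hdef
  have hh : Integrable h μ := hf.norm.sub (integrable_const t)
  set E : ℕ → Set Ω := fun n => {x | 0 < maximalSum T h n x} with hEdef
  have hEmono : Monotone E := monotone_nat_of_le_succ fun n x hx =>
    lt_of_lt_of_le hx (maximalSum_le_succ T h n x)
  have hE : ∀ n, μ (E n) ≤ ENNReal.ofReal ((∫ x, ‖f x‖ ∂μ) / t) := by
    intro n
    have h1 := setIntegral_maximalSum_pos_nonneg hT hh n
    have h2 : ∫ x in E n, h x ∂μ = (∫ x in E n, ‖f x‖ ∂μ) - μ.real (E n) * t := by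
      rw [hdef, integral_sub hf.norm.integrableOn (integrable_const t)]
      simp
    have h3 : ∫ x in E n, ‖f x‖ ∂μ ≤ ∫ x, ‖f x‖ ∂μ :=
      setIntegral_le_integral hf.norm (Eventually.of_forall fun x => norm_nonneg _)
    rw [← ofReal_measureReal]
    refine ENNReal.ofReal_le_ofReal ?_
    rw [le_div_iff₀ ht]
    linarith
  -- `f` is only a.e. measurable, so the exceptional set is enlarged to a measurable one of equal
  -- measure.
  refine ⟨(toMeasurable μ (⋃ n, E n))ᶜ, (measurableSet_toMeasurable _ _).compl, ?_, ?_⟩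
  · rw [compl_compl, measure_toMeasurable, hEmono.measure_iUnion]
    exact iSup_le hE
  · intro x hx n
    have hx' : x ∉ E n := fun hxn =>
      hx (subset_toMeasurable _ _ (Set.mem_iUnion.2 ⟨n, hxn⟩))
    have h1 := (sum_iterate_le_maximalSum T h n x).trans (not_lt.1 hx')
    simp only [hdef, Finset.sum_sub_distrib, Finset.sum_const, Finset.card_range,
      nsmul_eq_mul] at h1
    linarith

end Maximal

/-! ### The space of functions with almost uniformly Cauchy averages. -/

section AlmostUniform

variable {Ω : Type*} {T : Ω → Ω}

lemma average_add (z : ℂ) (n : ℕ) (f g : Ω → ℂ) (x : Ω) :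
    average T z n (f + g) x = average T z n f x + average T z n g x := by
  simp [average, mul_add, Finset.sum_add_distrib]

lemma average_sub (z : ℂ) (n : ℕ) (f g : Ω → ℂ) (x : Ω) :
    average T z n (f - g) x = average T z n f x - average T z n g x := by
  simp [average, mul_sub, Finset.sum_sub_distrib]

lemma average_const_smul (z c : ℂ) (n : ℕ) (f : Ω → ℂ) (x : Ω) :
    average T z n (c • f) x = c * average T z n f x := by
  simp only [average, Pi.smul_apply, smul_eq_mul, Finset.mul_sum]
  exact Finset.sum_congr rfl fun k _ => by ring

lemma norm_average_le {z : ℂ} (hz : ‖z‖ ≤ 1) (n : ℕ) (f : Ω → ℂ) (x : Ω) :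
    ‖average T z n f x‖ ≤ (n : ℝ)⁻¹ * ∑ k ∈ Finset.range n, ‖f (T^[k] x)‖ := by
  rw [average, norm_mul, one_div, norm_inv, Complex.norm_natCast]
  refine mul_le_mul_of_nonneg_left ((norm_sum_le _ _).trans (Finset.sum_le_sum fun k _ => ?_))
    (by positivity)
  rw [norm_mul, norm_pow]
  exact mul_le_of_le_one_left (norm_nonneg _) (pow_le_one₀ (norm_nonneg _) hz)

lemma norm_average_le_of_sum_le {z : ℂ} (hz : ‖z‖ ≤ 1) {t : ℝ} (ht : 0 ≤ t) {n : ℕ} {f : Ω → ℂ}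
    {x : Ω} (h : ∑ k ∈ Finset.range n, ‖f (T^[k] x)‖ ≤ n * t) :
    ‖average T z n f x‖ ≤ t := by
  rcases n.eq_zero_or_pos with rfl | hn
  · simpa [average] using ht
  · refine (norm_average_le hz n f x).trans ?_
    rwa [inv_mul_le_iff₀ (by exact_mod_cast hn)]

variable [MeasurableSpace Ω] {μ : Measure Ω}

lemma ae_average_congr (hT : MeasurePreserving T μ μ) {f g : Ω → ℂ} (h : f =ᵐ[μ] g) :
    ∀ᵐ x ∂μ, ∀ (z : ℂ) (n : ℕ), average T z n f x = average T z n g x := by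
  have : ∀ᵐ x ∂μ, ∀ k : ℕ, f (T^[k] x) = g (T^[k] x) := by
    rw [ae_all_iff]
    exact fun k => (hT.iterate k).quasiMeasurePreserving.ae h
  filter_upwards [this] with x hx z n
  simp [average, hx]

lemma exists_measurableSet_forall_of_ae {p : Ω → Prop} (h : ∀ᵐ x ∂μ, p x) :
    ∃ A, MeasurableSet A ∧ μ Aᶜ = 0 ∧ ∀ x ∈ A, p x :=
  ⟨(toMeasurable μ {x | ¬ p x})ᶜ, (measurableSet_toMeasurable _ _).compl, by
    rw [compl_compl, measure_toMeasurable]; exact h, fun x hx => by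
    by_contra hp
    exact hx (subset_toMeasurable μ _ hp)⟩

lemma measure_compl_inter_le {A B : Set Ω} {ε : ℝ} (hε : 0 < ε)
    (hA : μ Aᶜ ≤ ENNReal.ofReal (ε / 2)) (hB : μ Bᶜ ≤ ENNReal.ofReal (ε / 2)) :
    μ (A ∩ B)ᶜ ≤ ENNReal.ofReal ε := by
  rw [Set.compl_inter]
  refine (measure_union_le _ _).trans ((add_le_add hA hB).trans ?_)
  rw [← ENNReal.ofReal_add (by positivity) (by positivity), add_halves]

/-- Outside sets of arbitrarily small measure, the averages of `f` oscillate eventually by at most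
`η`, for each `z` on the unit circle. -/
def AlmostUniformCauchy {Ω : Type*} [MeasurableSpace Ω] (μ : Measure Ω) (T : Ω → Ω) (f : Ω → ℂ) :
    Prop :=
  ∀ ε : ℝ, 0 < ε → ∀ η : ℝ, 0 < η → ∃ A : Set Ω, MeasurableSet A ∧ μ Aᶜ ≤ ENNReal.ofReal ε ∧
    ∀ z : ℂ, ‖z‖ = 1 → ∃ N : ℕ, ∀ m ≥ N, ∀ n ≥ N, ∀ x ∈ A,
      ‖average T z m f x - average T z n f x‖ ≤ η

lemma AlmostUniformCauchy.add {f g : Ω → ℂ} (hf : AlmostUniformCauchy μ T f)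
    (hg : AlmostUniformCauchy μ T g) : AlmostUniformCauchy μ T (f + g) := by
  intro ε hε η hη
  obtain ⟨A, hA, hμA, hfA⟩ := hf (ε / 2) (by positivity) (η / 2) (by positivity)
  obtain ⟨B, hB, hμB, hgB⟩ := hg (ε / 2) (by positivity) (η / 2) (by positivity)
  refine ⟨A ∩ B, hA.inter hB, measure_compl_inter_le hε hμA hμB, fun z hz => ?_⟩
  obtain ⟨N, hN⟩ := hfA z hz
  obtain ⟨M, hM⟩ := hgB z hz
  refine ⟨max N M, fun m hm n hn x hx => ?_⟩
  have h1 := hN m (le_of_max_le_left hm) n (le_of_max_le_left hn) x hx.1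
  have h2 := hM m (le_of_max_le_right hm) n (le_of_max_le_right hn) x hx.2
  rw [average_add, average_add, add_sub_add_comm]
  exact (norm_add_le _ _).trans (by linarith)

lemma AlmostUniformCauchy.const_smul {f : Ω → ℂ} (hf : AlmostUniformCauchy μ T f) (c : ℂ) :
    AlmostUniformCauchy μ T (c • f) := by
  intro ε hε η hη
  obtain ⟨A, hA, hμA, hfA⟩ := hf ε hε (η / (‖c‖ + 1)) (by positivity)
  refine ⟨A, hA, hμA, fun z hz => ?_⟩
  obtain ⟨N, hN⟩ := hfA z hz
  refine ⟨N, fun m hm n hn x hx => ?_⟩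
  have h1 := hN m hm n hn x hx
  rw [le_div_iff₀ (by positivity)] at h1
  rw [average_const_smul, average_const_smul, ← mul_sub, norm_mul]
  nlinarith [norm_nonneg (average T z m f x - average T z n f x), norm_nonneg c]

lemma AlmostUniformCauchy.congr (hT : MeasurePreserving T μ μ) {f g : Ω → ℂ}
    (hf : AlmostUniformCauchy μ T f) (h : f =ᵐ[μ] g) : AlmostUniformCauchy μ T g := by
  obtain ⟨B, hB, hμB, hgB⟩ := exists_measurableSet_forall_of_ae (ae_average_congr hT h)
  intro ε hε η hη
  obtain ⟨A, hA, hμA, hfA⟩ := hf (ε / 2) (by positivity) η hη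
  refine ⟨A ∩ B, hA.inter hB, measure_compl_inter_le hε hμA (by simp [hμB]), fun z hz => ?_⟩
  obtain ⟨N, hN⟩ := hfA z hz
  refine ⟨N, fun m hm n hn x hx => ?_⟩
  rw [← hgB x hx.2, ← hgB x hx.2]
  exact hN m hm n hn x hx.1

/-- The class of functions with almost uniformly Cauchy averages is closed in `L¹`. -/
lemma AlmostUniformCauchy.of_approx [IsFiniteMeasure μ] (hT : MeasurePreserving T μ μ) {f : Ω → ℂ}
    (h : ∀ δ : ℝ, 0 < δ → ∃ g : Ω → ℂ, AlmostUniformCauchy μ T g ∧ Integrable (f - g) μ ∧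
      ∫ x, ‖(f - g) x‖ ∂μ ≤ δ) :
    AlmostUniformCauchy μ T f := by
  intro ε hε η hη
  -- Chosen so that the weak type inequality at height `η / 3` leaves out measure at most `ε / 2`.
  obtain ⟨g, hg, hfg, hδ⟩ := h (ε / 2 * (η / 3)) (by positivity)
  obtain ⟨A, hA, hμA, hgA⟩ := hg (ε / 2) (by positivity) (η / 3) (by positivity)
  obtain ⟨B, hB, hμB, hfB⟩ := exists_forall_sum_norm_iterate_le hT hfg (t := η / 3) (by positivity)
  refine ⟨A ∩ B, hA.inter hB, measure_compl_inter_le hε hμA (hμB.trans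
    (ENNReal.ofReal_le_ofReal ?_)), fun z hz => ?_⟩
  · rwa [div_le_iff₀ (by positivity)]
  · obtain ⟨N, hN⟩ := hgA z hz
    refine ⟨N, fun m hm n hn x hx => ?_⟩
    have h1 := hN m hm n hn x hx.1
    have h2 := norm_average_le_of_sum_le hz.le (by positivity) (hfB x hx.2 m)
    have h3 := norm_average_le_of_sum_le hz.le (by positivity) (hfB x hx.2 n)
    rw [average_sub] at h2 h3
    calc ‖average T z m f x - average T z n f x‖
        = ‖(average T z m f x - average T z m g x) + (average T z m g x - average T z n g x)
            - (average T z n f x - average T z n g x)‖ := by congr 1; ring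
      _ ≤ _ := norm_sub_le _ _
      _ ≤ _ := add_le_add (norm_add_le _ _) le_rfl
      _ ≤ η := by linarith

lemma AlmostUniformCauchy.mem_auWW {f : Ω → ℂ} (hf : AlmostUniformCauchy μ T f)
    (hm : AEStronglyMeasurable f μ) : f ∈ auWW μ T := by
  refine ⟨hm, fun ε hε => ?_⟩
  -- In `AlmostUniformCauchy` the set may depend on `η`. Intersecting the sets for `η = 1 / (j +
  -- 1)`, with exceptional measures summing to less than `ε`, removes this dependence.
  obtain ⟨ε', hε', hsum⟩ := ENNReal.exists_pos_sum_of_countable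
    (ENNReal.ofReal_pos.2 hε).ne' ℕ
  choose A hA hμA hfA using fun j : ℕ =>
    hf (ε' j) (by exact_mod_cast hε' j) (1 / ((j : ℝ) + 1)) Nat.one_div_pos_of_nat
  refine ⟨⋂ j, A j, MeasurableSet.iInter hA, ?_, fun z hz => ?_⟩
  · rw [Set.compl_iInter]
    refine (measure_iUnion_le _).trans ((ENNReal.tsum_le_tsum fun j => hμA j).trans ?_)
    simpa using hsum.le
  · have hC : UniformCauchySeqOn (fun n : ℕ => average T z n f) atTop (⋂ j, A j) := by
      rw [Metric.uniformCauchySeqOn_iff]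
      intro η hη
      obtain ⟨j, hj⟩ := exists_nat_one_div_lt hη
      obtain ⟨N, hN⟩ := hfA j z hz
      refine ⟨N, fun m hm n hn x hx => ?_⟩
      rw [dist_eq_norm]
      exact (hN m hm n hn x (Set.mem_iInter.1 hx j)).trans_lt hj
    have hlim : ∀ x, ∃ y, x ∈ (⋂ j, A j) → Tendsto (fun n => average T z n f x) atTop (𝓝 y) := by
      intro x
      by_cases hx : x ∈ ⋂ j, A j
      · obtain ⟨y, hy⟩ := cauchySeq_tendsto_of_complete (hC.cauchySeq hx)
        exact ⟨y, fun _ => hy⟩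
      · exact ⟨0, fun h => absurd h hx⟩
    choose g hg using hlim
    exact ⟨g, hC.tendstoUniformlyOn_of_tendsto fun x hx => hg x hx⟩

end AlmostUniform

/-! ### Weighted Koopman operators and the mean ergodic theorem. -/

section Koopman

variable {Ω : Type*} [MeasurableSpace Ω] {μ : Measure Ω} {T : Ω → Ω}

/-- The operator `u ↦ z • u ∘ T` on `L²`. -/
noncomputable def weightedKoopman (hT : MeasurePreserving T μ μ) (z : ℂ) :
    Lp ℂ 2 μ →L[ℂ] Lp ℂ 2 μ :=
  z • (Lp.compMeasurePreservingₗᵢ ℂ T hT).toContinuousLinearMap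

lemma norm_weightedKoopman_le (hT : MeasurePreserving T μ μ) {z : ℂ} (hz : ‖z‖ ≤ 1) :
    ‖weightedKoopman hT z‖ ≤ 1 := by
  rw [weightedKoopman, norm_smul]
  exact mul_le_one₀ hz (norm_nonneg _) (LinearIsometry.norm_toContinuousLinearMap_le _)

lemma coeFn_weightedKoopman (hT : MeasurePreserving T μ μ) (z : ℂ) (u : Lp ℂ 2 μ) :
    weightedKoopman hT z u =ᵐ[μ] fun x => z * u (T x) := by
  have h1 : weightedKoopman hT z u = z • Lp.compMeasurePreserving T hT u := rfl
  rw [h1]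
  filter_upwards [Lp.coeFn_smul z (Lp.compMeasurePreserving T hT u),
    Lp.coeFn_compMeasurePreserving u hT] with x hx hx'
  rw [hx, Pi.smul_apply, hx', smul_eq_mul, Function.comp_apply]

lemma coeFn_weightedKoopman_iterate (hT : MeasurePreserving T μ μ) (z : ℂ) (u : Lp ℂ 2 μ) (k : ℕ) :
    (weightedKoopman hT z)^[k] u =ᵐ[μ] fun x => z ^ k * u (T^[k] x) := by
  induction k with
  | zero => simp
  | succ k ih =>
    rw [Function.iterate_succ_apply']
    filter_upwards [coeFn_weightedKoopman hT z ((weightedKoopman hT z)^[k] u),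
      hT.quasiMeasurePreserving.ae ih] with x hx hx'
    rw [hx, hx', Function.iterate_succ_apply]
    ring

lemma coeFn_birkhoffAverage_weightedKoopman (hT : MeasurePreserving T μ μ) (z : ℂ) (n : ℕ)
    (u : Lp ℂ 2 μ) :
    (birkhoffAverage ℂ (weightedKoopman hT z) id n u : Lp ℂ 2 μ) =ᵐ[μ] average T z n u := by
  have hsum : (birkhoffSum (weightedKoopman hT z) id n u : Lp ℂ 2 μ) =ᵐ[μ]
      fun x => ∑ k ∈ Finset.range n, z ^ k * u (T^[k] x) := by
    induction n with
    | zero =>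
      filter_upwards [Lp.coeFn_zero ℂ 2 μ] with x hx
      simpa using hx
    | succ n ih =>
      rw [birkhoffSum_succ]
      filter_upwards [ih, Lp.coeFn_add (birkhoffSum (weightedKoopman hT z) id n u)
        (id ((weightedKoopman hT z)^[n] u)), coeFn_weightedKoopman_iterate hT z u n]
        with x h1 h2 h3
      rw [h2, Pi.add_apply, h1, id, h3, Finset.sum_range_succ]
  rw [birkhoffAverage]
  filter_upwards [Lp.coeFn_smul (n : ℂ)⁻¹ (birkhoffSum (weightedKoopman hT z) id n u), hsum]
    with x h1 h2
  rw [h1, Pi.smul_apply, h2, average, smul_eq_mul, one_div]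

/-- The mean ergodic theorem for weighted averages in `L²`. -/
lemma exists_tendsto_birkhoffAverage_weightedKoopman (hT : MeasurePreserving T μ μ) {z : ℂ}
    (hz : ‖z‖ ≤ 1) (u : Lp ℂ 2 μ) :
    ∃ w : Lp ℂ 2 μ, weightedKoopman hT z w = w ∧
      (∀ v, weightedKoopman hT z v = v → inner ℂ v w = inner ℂ v u) ∧
      Tendsto (fun n => birkhoffAverage ℂ (weightedKoopman hT z) id n u) atTop (𝓝 w) := by
  -- The space of fixed vectors; the limit is the orthogonal projection onto it.
  set S := (weightedKoopman hT z).eqLocus (1 : Lp ℂ 2 μ →L[ℂ] Lp ℂ 2 μ)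
  refine ⟨S.orthogonalProjectionOnto u, (S.orthogonalProjectionOnto u).2, fun v hv => ?_,
    (weightedKoopman hT z).tendsto_birkhoffAverage_orthogonalProjection
      (norm_weightedKoopman_le hT hz) u⟩
  have hv' : v ∈ S := hv
  have := Submodule.inner_orthogonalProjectionOnto_eq_of_mem_left (K := S) ⟨v, hv'⟩ u
  exact this

lemma integral_norm_le_of_Lp [IsFiniteMeasure μ] (v : Lp ℂ 2 μ) :
    ∫ x, ‖v x‖ ∂μ ≤ ‖v‖ * √(μ.real Set.univ) := by
  have h := eLpNorm_le_eLpNorm_mul_rpow_measure_univ (p := 1) (q := 2) (μ := μ) (by norm_num)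
    (Lp.aestronglyMeasurable v)
  rw [integral_norm_eq_lintegral_enorm (Lp.aestronglyMeasurable v), ← eLpNorm_one_eq_lintegral_enorm]
  refine (ENNReal.toReal_mono (ENNReal.mul_ne_top (Lp.eLpNorm_ne_top v)
    (ENNReal.rpow_ne_top_of_nonneg (by norm_num) (measure_ne_top μ _))) h).trans (le_of_eq ?_)
  rw [ENNReal.toReal_mul, Lp.norm_def, ← ENNReal.toReal_rpow, Real.sqrt_eq_rpow]
  norm_num [Measure.real]

end Koopman

/-! ### Averages of bounded functions along every orbit. -/

section BoundedObservable

variable {Ω : Type*} {T : Ω → Ω}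

lemma average_average (z : ℂ) (m n : ℕ) (φ : Ω → ℂ) (x : Ω) :
    average T z n (average T z m φ) x = average T z m (average T z n φ) x := by
  simp only [average, Finset.mul_sum]
  rw [Finset.sum_comm]
  refine Finset.sum_congr rfl fun i _ => Finset.sum_congr rfl fun j _ => ?_
  rw [← Function.iterate_add_apply, ← Function.iterate_add_apply, add_comm i j]
  ring

/-- Moving the starting point one step along the orbit changes only two bounded terms of the sum. -/
lemma tendsto_average_iterate_sub_average {φ : Ω → ℂ} (hφ : Bornology.IsBounded (Set.range φ))
    (m : ℕ) (x : Ω) :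
    Tendsto (fun n => average T 1 n φ (T^[m] x) - average T 1 n φ x) atTop (𝓝 0) := by
  have hB : ∀ n y, average T 1 n φ y = birkhoffAverage ℂ T φ n y := by
    intro n y
    simp [average, birkhoffAverage, birkhoffSum]
  induction m with
  | zero => simp
  | succ m ih =>
    have h1 := tendsto_birkhoffAverage_apply_sub_birkhoffAverage' ℂ hφ T (T^[m] x)
    simp only [← hB, ← Function.iterate_succ_apply'] at h1
    simpa using h1.add ih

/-- `φ - average T 1 M φ` is a mean of the coboundaries `φ - φ ∘ T^m`, so its averages vanish in the
limit at every point. -/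
lemma tendsto_average_sub_average {φ : Ω → ℂ} (hφ : Bornology.IsBounded (Set.range φ)) {M : ℕ}
    (hM : 0 < M) (x : Ω) :
    Tendsto (fun n => average T 1 n (φ - average T 1 M φ) x) atTop (𝓝 0) := by
  have h1 : ∀ n, average T 1 n (φ - average T 1 M φ) x = - ((1 / (M : ℂ)) *
      ∑ m ∈ Finset.range M, (average T 1 n φ (T^[m] x) - average T 1 n φ x)) := by
    intro n
    have hM' : (M : ℂ) ≠ 0 := by exact_mod_cast hM.ne'
    rw [average_sub, average_average, average]
    simp only [one_pow, one_mul, Finset.sum_sub_distrib, Finset.sum_const, Finset.card_range,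
      nsmul_eq_mul]
    rw [show average T 1 M (average T 1 n φ) x =
      (1 / (M : ℂ)) * ∑ m ∈ Finset.range M, average T 1 n φ (T^[m] x) by
        rw [average]; simp]
    simp only [average, one_pow, one_mul]
    field_simp
    ring
  simp only [h1]
  have h2 := tendsto_finsetSum (Finset.range M) fun m _ =>
    tendsto_average_iterate_sub_average (T := T) hφ m x
  simpa using (h2.const_mul (1 / (M : ℂ))).neg

lemma average_one_const (T : Ω → Ω) (c : ℂ) {n : ℕ} (hn : 0 < n) (x : Ω) :
    average T 1 n (fun _ => c) x = c := by
  have : (n : ℂ) ≠ 0 := by exact_mod_cast hn.ne'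
  simp [average, this]

end BoundedObservable

/-! ### Birkhoff's theorem, from the mean ergodic theorem and the maximal inequality. -/

section Birkhoff

variable {Ω : Type*} [MeasurableSpace Ω] {μ : Measure Ω} {T : Ω → Ω}

/-- By ergodicity the `L²` limit is constant; pairing with the fixed vector `1` identifies the
constant as the mean. -/
lemma exists_integral_norm_average_sub_le [IsFiniteMeasure μ] (hT : Ergodic T μ) {φ : Ω → ℂ}
    (hφ : MemLp φ 2 μ) {δ : ℝ} (hδ : 0 < δ) :
    ∃ M : ℕ, 0 < M ∧ ∫ x, ‖average T 1 M φ x - ⨍ y, φ y ∂μ‖ ∂μ ≤ δ := by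
  have hT' := hT.toMeasurePreserving
  rcases eq_or_ne μ 0 with rfl | hμ
  · exact ⟨1, one_pos, by simpa using hδ.le⟩
  have : NeZero μ := ⟨hμ⟩
  obtain ⟨w, hw, hinner, hlim⟩ :=
    exists_tendsto_birkhoffAverage_weightedKoopman hT' (z := 1) (by simp) hφ.toLp
  have hwT : w ∘ T =ᵐ[μ] w := by
    have := coeFn_weightedKoopman hT' 1 w
    rw [hw] at this
    filter_upwards [this] with x hx
    simpa using hx.symm
  obtain ⟨a, ha⟩ := hT.ae_eq_const_of_ae_eq_comp_ae (Lp.aestronglyMeasurable w) hwT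
  have hone : weightedKoopman hT' 1 (Lp.const 2 μ (1 : ℂ)) = Lp.const 2 μ (1 : ℂ) := by
    apply Lp.ext
    have h := Lp.coeFn_const (p := 2) (μ := μ) (1 : ℂ)
    filter_upwards [coeFn_weightedKoopman hT' 1 (Lp.const 2 μ (1 : ℂ)), h,
      hT'.quasiMeasurePreserving.ae h] with x h1 h2 h3
    rw [h1, h2, h3]
    simp
  have haφ : a = ⨍ y, φ y ∂μ := by
    have h1 := hinner _ hone
    have h2 : ∀ v : Lp ℂ 2 μ, inner ℂ (Lp.const 2 μ (1 : ℂ)) v = ∫ x, v x ∂μ := by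
      intro v
      rw [L2.inner_def]
      simp
    rw [h2, h2, integral_congr_ae hφ.coeFn_toLp, integral_congr_ae ha] at h1
    rw [MeasureTheory.average_eq, ← h1]
    simp only [Function.const_apply, integral_const]
    rw [inv_smul_smul₀]
    simp [Measure.real, ENNReal.toReal_eq_zero_iff, hμ]
  have hsub : Tendsto (fun n => ‖birkhoffAverage ℂ (weightedKoopman hT' 1) id n hφ.toLp - w‖
      * √(μ.real Set.univ)) atTop (𝓝 0) := by
    simpa using (tendsto_iff_norm_sub_tendsto_zero.1 hlim).mul_const (√(μ.real Set.univ))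
  obtain ⟨M, hM, hM0⟩ := ((hsub.eventually (ge_mem_nhds hδ)).and (eventually_gt_atTop 0)).exists
  refine ⟨M, hM0, le_trans (le_of_eq ?_) ((integral_norm_le_of_Lp _).trans hM)⟩
  refine integral_congr_ae ?_
  filter_upwards [Lp.coeFn_sub (birkhoffAverage ℂ (weightedKoopman hT' 1) id M hφ.toLp) w,
    coeFn_birkhoffAverage_weightedKoopman hT' 1 M hφ.toLp, ha,
    ae_average_congr hT' hφ.coeFn_toLp] with x h1 h2 h3 h4
  rw [h1, Pi.sub_apply, h2, h3, h4, haφ, Function.const_apply]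

lemma integrable_average (hT : MeasurePreserving T μ μ) {φ : Ω → ℂ} (hφ : Integrable φ μ) (z : ℂ)
    (n : ℕ) : Integrable (average T z n φ) μ :=
  (integrable_finsetSum _ fun k _ =>
    ((hT.iterate k).integrable_comp_of_integrable hφ).const_mul (z ^ k)).const_mul _

lemma exists_bounded_integral_norm_sub_le [IsFiniteMeasure μ] {φ : Ω → ℂ} (hφ : Integrable φ μ)
    {δ : ℝ} (hδ : 0 < δ) :
    ∃ s : Ω → ℂ, Bornology.IsBounded (Set.range s) ∧ MemLp s 2 μ ∧ Integrable s μ ∧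
      ∫ x, ‖φ x - s x‖ ∂μ ≤ δ := by
  obtain ⟨s, hs, -⟩ := (memLp_one_iff_integrable.2 hφ).exists_simpleFunc_eLpNorm_sub_lt
    ENNReal.one_ne_top (ENNReal.ofReal_pos.2 hδ).ne'
  have hs1 : Integrable s μ := s.integrable_of_isFiniteMeasure
  refine ⟨s, s.finite_range.isBounded, s.memLp_of_isFiniteMeasure 2 μ, hs1, ?_⟩
  rw [eLpNorm_one_eq_lintegral_enorm] at hs
  exact (integral_norm_eq_lintegral_enorm (hφ.sub hs1).aestronglyMeasurable).le.trans
    (ENNReal.toReal_le_of_le_ofReal hδ.le hs.le)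

/-- With `s` bounded and close to `φ`, split `φ` minus its mean as `ρ + (s - average T 1 M s)`. The
averages of the second term tend to zero everywhere, and `ρ` is small in `L¹`, so the maximal
inequality controls its averages. -/
lemma exists_eventually_norm_average_sub_le [IsFiniteMeasure μ] (hT : Ergodic T μ) {φ : Ω → ℂ}
    (hφ : Integrable φ μ) {t ε : ℝ} (ht : 0 < t) (hε : 0 < ε) :
    ∃ A : Set Ω, μ Aᶜ ≤ ENNReal.ofReal ε ∧
      ∀ x ∈ A, ∀ᶠ n in atTop, ‖average T 1 n φ x - ⨍ y, φ y ∂μ‖ ≤ t := by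
  have hT' := hT.toMeasurePreserving
  -- `ρ` collects three errors of size `δ`, and `3 * δ / (t / 2) = ε`.
  set δ : ℝ := ε * (t / 2) / 3 with hδ
  have hδ0 : 0 < δ := by positivity
  obtain ⟨s, hsb, hs2, hs1, h1⟩ := exists_bounded_integral_norm_sub_le hφ hδ0
  obtain ⟨M, hM, hMδ⟩ := exists_integral_norm_average_sub_le hT hs2 hδ0
  have h3 : ∫ _, ‖(⨍ y, s y ∂μ) - ⨍ y, φ y ∂μ‖ ∂μ ≤ δ := by
    rw [integral_const, smul_eq_mul, ← Real.norm_of_nonneg (measureReal_nonneg (μ := μ)),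
      ← norm_smul, smul_sub, measure_smul_average, measure_smul_average,
      ← integral_sub hs1 hφ]
    refine (norm_integral_le_integral_norm _).trans ?_
    simpa only [norm_sub_rev] using h1
  set ρ : Ω → ℂ := φ - (fun _ => ⨍ y, φ y ∂μ) - (s - average T 1 M s) with hρ
  have i2 := integrable_average hT' hs1 1 M
  have hρi : Integrable ρ μ := (hφ.sub (integrable_const _)).sub (hs1.sub i2)
  have hρδ : ∫ x, ‖ρ x‖ ∂μ ≤ 3 * δ := by
    have i1 : Integrable (fun x => ‖φ x - s x‖) μ := (hφ.sub hs1).norm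
    have i3 : Integrable (fun x => ‖average T 1 M s x - ⨍ y, s y ∂μ‖) μ :=
      (i2.sub (integrable_const _)).norm
    have i4 : Integrable (fun _ : Ω => ‖(⨍ y, s y ∂μ) - ⨍ y, φ y ∂μ‖) μ := integrable_const _
    calc ∫ x, ‖ρ x‖ ∂μ ≤ ∫ x, (‖φ x - s x‖ + ‖average T 1 M s x - ⨍ y, s y ∂μ‖ +
          ‖(⨍ y, s y ∂μ) - ⨍ y, φ y ∂μ‖) ∂μ := by
          refine integral_mono hρi.norm ((i1.add i3).add i4) fun x => ?_
          have : ρ x = (φ x - s x) + (average T 1 M s x - ⨍ y, s y ∂μ) +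
              ((⨍ y, s y ∂μ) - ⨍ y, φ y ∂μ) := by
            simp only [hρ, Pi.sub_apply]
            ring
          rw [this]
          exact norm_add₃_le
      _ = (∫ x, ‖φ x - s x‖ ∂μ) + (∫ x, ‖average T 1 M s x - ⨍ y, s y ∂μ‖ ∂μ) +
          ∫ _, ‖(⨍ y, s y ∂μ) - ⨍ y, φ y ∂μ‖ ∂μ := by
        rw [integral_add (by exact i1.add i3) i4, integral_add i1 i3]
      _ ≤ _ := by linarith
  obtain ⟨A, -, hμA, hA⟩ := exists_forall_sum_norm_iterate_le hT' hρi (t := t / 2) (by positivity)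
  refine ⟨A, hμA.trans (ENNReal.ofReal_le_ofReal ?_), fun x hx => ?_⟩
  · rw [div_le_iff₀ (by positivity)]
    refine hρδ.trans (le_of_eq ?_)
    rw [hδ]
    ring
  · have hlim := tendsto_average_sub_average (T := T)
      hsb hM x
    filter_upwards [eventually_gt_atTop 0,
      (tendsto_zero_iff_norm_tendsto_zero.1 hlim).eventually (ge_mem_nhds (half_pos ht))]
      with n hn hn'
    have h4 := norm_average_le_of_sum_le (z := 1) (by simp) (by positivity) (hA x hx n)
    have h5 : average T 1 n φ x - ⨍ y, φ y ∂μ =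
        average T 1 n ρ x + average T 1 n (s - average T 1 M s) x := by
      rw [hρ, average_sub, average_sub, average_one_const T _ hn]
      ring
    rw [h5]
    exact (norm_add_le _ _).trans (by linarith)

/-- **Birkhoff's pointwise ergodic theorem** for ergodic maps of a finite measure space. -/
theorem ae_tendsto_average [IsFiniteMeasure μ] (hT : Ergodic T μ) {φ : Ω → ℂ}
    (hφ : Integrable φ μ) :
    ∀ᵐ x ∂μ, Tendsto (fun n => average T 1 n φ x) atTop (𝓝 (⨍ y, φ y ∂μ)) := by
  have h : ∀ j : ℕ, ∀ᵐ x ∂μ, ∀ᶠ n in atTop,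
      ‖average T 1 n φ x - ⨍ y, φ y ∂μ‖ ≤ 1 / ((j : ℝ) + 1) := by
    intro j
    rw [ae_iff, ← nonpos_iff_eq_zero]
    refine ENNReal.le_of_forall_pos_le_add fun ε hε _ => ?_
    obtain ⟨A, hμA, hA⟩ := exists_eventually_norm_average_sub_le hT hφ
      (t := 1 / ((j : ℝ) + 1)) Nat.one_div_pos_of_nat (ε := ε) (by exact_mod_cast hε)
    rw [zero_add, ← ENNReal.ofReal_coe_nnreal]
    exact (measure_mono (Set.compl_subset_compl.2 fun x hxA => hA x hxA)).trans hμA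
  filter_upwards [ae_all_iff.2 h] with x hx
  rw [tendsto_iff_norm_sub_tendsto_zero, Metric.tendsto_atTop']
  intro η hη
  obtain ⟨j, hj⟩ := exists_nat_one_div_lt hη
  obtain ⟨N, hN⟩ := eventually_atTop.1 (hx j)
  refine ⟨N, fun n hn => ?_⟩
  rw [dist_zero_right, norm_norm]
  exact (hN n hn.le).trans_lt hj

end Birkhoff

/-! ### Invariant Hilbert–Schmidt kernels and autocorrelations. -/

section Kernel

variable {Ω : Type*} [MeasurableSpace Ω] {μ : Measure Ω} {T : Ω → Ω}

lemma norm_toLp_sq {f : Ω → ℂ} (hf : MemLp f 2 μ) : ‖hf.toLp‖ ^ 2 = ∫ x, ‖f x‖ ^ 2 ∂μ := by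
  have h : inner ℂ hf.toLp hf.toLp = ((∫ x, ‖f x‖ ^ 2 ∂μ : ℝ) : ℂ) := by
    rw [L2.inner_def, ← integral_complex_ofReal]
    refine integral_congr_ae ?_
    filter_upwards [hf.coeFn_toLp] with x hx
    rw [hx, inner_self_eq_norm_sq_to_K]
    simp
  rw [inner_self_eq_norm_sq_to_K] at h
  refine Complex.ofReal_injective ?_
  rw [← h, Complex.ofReal_pow]
  rfl

lemma norm_integral_mul_le {f : Ω → ℂ} (hf : MemLp f 2 μ) (v : Lp ℂ 2 μ) :
    ‖∫ x, f x * v x ∂μ‖ ≤ √(∫ x, ‖f x‖ ^ 2 ∂μ) * ‖v‖ := by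
  have hf' : MemLp (fun x => star (f x)) 2 μ := hf.star
  have h : ∫ x, f x * v x ∂μ = inner ℂ hf'.toLp v := by
    rw [L2.inner_def]
    refine integral_congr_ae ?_
    filter_upwards [hf'.coeFn_toLp] with x hx
    rw [hx]
    simp [mul_comm]
  have h2 : √(∫ x, ‖f x‖ ^ 2 ∂μ) = ‖hf'.toLp‖ := by
    rw [Real.sqrt_eq_iff_eq_sq (integral_nonneg fun x => by positivity) (norm_nonneg _),
      norm_toLp_sq]
    simp
  rw [h, h2]
  exact norm_inner_le_norm _ _

lemma memLp_mul_star_prod [SFinite μ] {f : Ω → ℂ} (hf : MemLp f 2 μ) :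
    MemLp (fun p : Ω × Ω => f p.1 * star (f p.2)) 2 (μ.prod μ) := by
  have hm : AEStronglyMeasurable (fun p : Ω × Ω => f p.1 * star (f p.2)) (μ.prod μ) :=
    hf.1.comp_fst.mul hf.1.comp_snd.star
  rw [memLp_two_iff_integrable_sq_norm hm]
  have h := (memLp_two_iff_integrable_sq_norm hf.1).1 hf
  simpa [mul_pow] using h.mul_prod h

variable [IsFiniteMeasure μ]

lemma MemLp.ae_memLp_section {K : Ω × Ω → ℂ} (hK : MemLp K 2 (μ.prod μ)) :
    ∀ᵐ x ∂μ, MemLp (fun y => K (x, y)) 2 μ := by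
  have h := (memLp_two_iff_integrable_sq_norm hK.1).1 hK
  filter_upwards [h.prod_right_ae, hK.1.prodMk_left] with x h1 h2
  exact (memLp_two_iff_integrable_sq_norm h2).2 h1

lemma memLp_integral_kernel {K : Ω × Ω → ℂ} (hK : MemLp K 2 (μ.prod μ)) (u : Lp ℂ 2 μ) :
    MemLp (fun x => ∫ y, K (x, y) * u y ∂μ) 2 μ := by
  have hm : AEStronglyMeasurable (fun x => ∫ y, K (x, y) * u y ∂μ) μ :=
    AEStronglyMeasurable.integral_prod_right' (f := fun p : Ω × Ω => K p * u p.2)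
      (hK.1.mul (Lp.aestronglyMeasurable u).comp_snd)
  rw [memLp_two_iff_integrable_sq_norm hm]
  have h := ((memLp_two_iff_integrable_sq_norm hK.1).1 hK).integral_prod_left
  refine (h.mul_const (‖u‖ ^ 2)).mono' (hm.norm.pow 2) ?_
  filter_upwards [MemLp.ae_memLp_section hK] with x hx
  rw [Real.norm_of_nonneg (by positivity)]
  refine (pow_le_pow_left₀ (norm_nonneg _) (norm_integral_mul_le hx u) 2).trans (le_of_eq ?_)
  rw [mul_pow, Real.sq_sqrt (integral_nonneg fun x => by positivity)]

/-- The averages of a function in the range of an invariant kernel operator are obtained by applying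
the operator to averages. -/
lemma ae_average_integral_kernel (hT : MeasurePreserving T μ μ) {K : Ω × Ω → ℂ}
    (hKm : StronglyMeasurable K) (hK : MemLp K 2 (μ.prod μ))
    (hinv : K ∘ Prod.map T T =ᵐ[μ.prod μ] K) (u : Lp ℂ 2 μ) :
    ∀ᵐ x ∂μ, ∀ (z : ℂ) (n : ℕ), average T z n (fun x => ∫ y, K (x, y) * u y ∂μ) x =
      ∫ y, K (x, y) * average T z n u y ∂μ := by
  have hTT : MeasurePreserving (Prod.map T T) (μ.prod μ) (μ.prod μ) := hT.prod hT
  have hinvk : ∀ k : ℕ, ∀ᵐ p ∂(μ.prod μ), K (T^[k] p.1, T^[k] p.2) = K p := by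
    intro k
    induction k with
    | zero => simp
    | succ k ih =>
      filter_upwards [hinv, hTT.quasiMeasurePreserving.ae ih] with p h1 h2
      rw [Function.iterate_succ_apply, Function.iterate_succ_apply]
      exact h2.trans h1
  have h2 := ae_all_iff.2 fun k => Measure.ae_ae_of_ae_prod (hinvk k)
  filter_upwards [MemLp.ae_memLp_section hK, h2] with x hx hxk z n
  -- Substitute `T^[k] y` for `y` by invariance of `μ`, then use the invariance of `K`; no inverse
  -- of `T` is needed.
  have hstep : ∀ k, ∫ y, K (T^[k] x, y) * u y ∂μ = ∫ y, K (x, y) * u (T^[k] y) ∂μ := by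
    intro k
    have hTk := hT.iterate k
    have hm : AEStronglyMeasurable (fun y => K (T^[k] x, y) * u y) (μ.map T^[k]) :=
      ((hKm.comp_measurable measurable_prodMk_left).mul
        (Lp.stronglyMeasurable u)).aestronglyMeasurable
    have := integral_map hTk.aemeasurable hm
    rw [hTk.map_eq] at this
    rw [this]
    refine integral_congr_ae ?_
    filter_upwards [hxk k] with y hy
    rw [hy]
  have hint : ∀ k, Integrable (fun y => K (x, y) * u (T^[k] y)) μ := fun k =>
    hx.integrable_mul ((Lp.memLp u).comp_measurePreserving (hT.iterate k))
  simp only [average, hstep]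
  calc (1 / (n : ℂ)) * ∑ k ∈ Finset.range n, z ^ k * ∫ y, K (x, y) * u (T^[k] y) ∂μ
      = ∫ y, (1 / (n : ℂ)) * ∑ k ∈ Finset.range n, z ^ k * (K (x, y) * u (T^[k] y)) ∂μ := by
        rw [integral_const_mul, integral_finsetSum _ fun k _ => (hint k).const_mul _]
        simp only [integral_const_mul]
    _ = _ := by
        congr 1 with y
        simp only [Finset.mul_sum]
        exact Finset.sum_congr rfl fun k _ => by ring

/-- Functions in the range of an invariant Hilbert–Schmidt kernel operator have almost uniformly
Cauchy weighted averages. -/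
lemma almostUniformCauchy_integral_kernel (hT : MeasurePreserving T μ μ) {K : Ω × Ω → ℂ}
    (hKm : StronglyMeasurable K) (hK : MemLp K 2 (μ.prod μ))
    (hinv : K ∘ Prod.map T T =ᵐ[μ.prod μ] K) (u : Lp ℂ 2 μ) :
    AlmostUniformCauchy μ T (fun x => ∫ y, K (x, y) * u y ∂μ) := by
  intro ε hε η hη
  have hN : Integrable (fun x => ((∫ y, ‖K (x, y)‖ ^ 2 ∂μ : ℝ) : ℂ)) μ :=
    ((memLp_two_iff_integrable_sq_norm hK.1).1 hK).integral_prod_left.ofReal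
  set I := ∫ x, ‖((∫ y, ‖K (x, y)‖ ^ 2 ∂μ : ℝ) : ℂ)‖ ∂μ with hI
  have hI0 : 0 ≤ I := integral_nonneg fun x => norm_nonneg _
  set t := (I + 1) / (ε / 2) with ht
  have ht0 : 0 < t := by positivity
  obtain ⟨A, hA, hμA, hAt⟩ := exists_forall_sum_norm_iterate_le hT hN ht0
  obtain ⟨B, hB, hμB, hBx⟩ := exists_measurableSet_forall_of_ae
    ((MemLp.ae_memLp_section hK).and (ae_average_integral_kernel hT hKm hK hinv u))
  refine ⟨A ∩ B, hA.inter hB, measure_compl_inter_le hε (hμA.trans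
    (ENNReal.ofReal_le_ofReal ?_)) (by simp [hμB]), fun z hz => ?_⟩
  · rw [div_le_iff₀ ht0, ht, mul_div_cancel₀ _ (by positivity)]
    linarith
  obtain ⟨w, -, -, hlim⟩ := exists_tendsto_birkhoffAverage_weightedKoopman hT hz.le u
  -- By Cauchy–Schwarz the oscillation at `x` is at most the norm of the section `K (x, ·)`, which
  -- is at most `√t` on `A`, times the `L²` oscillation. Only `N` depends on `z`.
  obtain ⟨N, hN⟩ := Metric.cauchySeq_iff.1 hlim.cauchySeq (η / √t) (by positivity)
  refine ⟨N, fun m hm n hn x hx => ?_⟩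
  obtain ⟨hxK, hxavg⟩ := hBx x hx.2
  have hmem : ∀ n, Integrable (fun y => K (x, y) * average T z n u y) μ := fun n =>
    hxK.integrable_mul ((memLp_congr_ae (coeFn_birkhoffAverage_weightedKoopman hT z n u)).1
      (Lp.memLp _))
  rw [hxavg, hxavg, ← integral_sub (hmem m) (hmem n)]
  set Bm : Lp ℂ 2 μ := birkhoffAverage ℂ (weightedKoopman hT z) id m u with hBm
  set Bn : Lp ℂ 2 μ := birkhoffAverage ℂ (weightedKoopman hT z) id n u with hBn
  have h1 : ∫ y, (K (x, y) * average T z m u y - K (x, y) * average T z n u y) ∂μ =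
      ∫ y, K (x, y) * (Bm - Bn : Lp ℂ 2 μ) y ∂μ := by
    refine integral_congr_ae ?_
    filter_upwards [coeFn_birkhoffAverage_weightedKoopman hT z m u,
      coeFn_birkhoffAverage_weightedKoopman hT z n u, Lp.coeFn_sub Bm Bn] with y h1 h2 h3
    rw [h3, Pi.sub_apply, h1, h2, mul_sub]
  rw [h1]
  have h2 : ∫ y, ‖K (x, y)‖ ^ 2 ∂μ ≤ t := by
    -- The case `n = 1` of the maximal inequality, which is Markov's inequality.
    have := hAt x hx.1 1
    simp only [Finset.range_one, Finset.sum_singleton, Function.iterate_zero_apply,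
      Complex.norm_real, Nat.cast_one, one_mul] at this
    exact (le_abs_self _).trans this
  have h3 := (hN m hm n hn).le
  rw [dist_eq_norm, le_div_iff₀ (by positivity), mul_comm] at h3
  exact (norm_integral_mul_le hxK _).trans
    ((mul_le_mul_of_nonneg_right (Real.sqrt_le_sqrt h2) (norm_nonneg _)).trans h3)

/-- The iterates of `f ⊗ conj f` are again rank-one kernels, so by Fubini the inner product of two
of them factors as `conj c * c`, with `c` an autocorrelation. -/
lemma norm_sq_of_ae_eq_average_mul_star (hT : MeasurePreserving T μ μ) {f : Ω → ℂ}
    (hf : MemLp f 2 μ) (H : ℕ) (B : Lp ℂ 2 (μ.prod μ))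
    (hB : B =ᵐ[μ.prod μ] average (Prod.map T T) 1 H (fun p : Ω × Ω => f p.1 * star (f p.2))) :
    ‖B‖ ^ 2 = ((H : ℝ)⁻¹) ^ 2 * ∑ h ∈ Finset.range H, ∑ j ∈ Finset.range H,
      ‖∫ x, f (T^[h] x) * star (f (T^[j] x)) ∂μ‖ ^ 2 := by
  have hfk : ∀ k, MemLp (fun x => f (T^[k] x)) 2 μ := fun k =>
    hf.comp_measurePreserving (hT.iterate k)
  set c : ℕ → ℕ → ℂ := fun h j => ∫ x, f (T^[h] x) * star (f (T^[j] x)) ∂μ with hc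
  set Φ : ℕ → Ω × Ω → ℂ := fun k p => f (T^[k] p.1) * star (f (T^[k] p.2)) with hΦ
  have hint : ∀ h j, Integrable (fun p => star (Φ h p) * Φ j p) (μ.prod μ) := fun h j =>
    (memLp_mul_star_prod (hfk h)).star.integrable_mul (memLp_mul_star_prod (hfk j))
  have hval : ∀ h j, ∫ p, star (Φ h p) * Φ j p ∂(μ.prod μ) = ((‖c h j‖ ^ 2 : ℝ) : ℂ) := by
    intro h j
    have e1 : ∀ p : Ω × Ω, star (Φ h p) * Φ j p = star (f (T^[h] p.1) * star (f (T^[j] p.1))) *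
        (f (T^[h] p.2) * star (f (T^[j] p.2))) := by
      intro p
      simp only [hΦ, star_mul, star_star]
      ring
    simp only [e1]
    rw [integral_prod_mul (fun x => star (f (T^[h] x) * star (f (T^[j] x))))
      (fun x => f (T^[h] x) * star (f (T^[j] x)))]
    have e2 : ∫ x, star (f (T^[h] x) * star (f (T^[j] x))) ∂μ = star (c h j) := integral_conj
    rw [e2]
    change star (c h j) * c h j = _
    rw [Complex.star_def, Complex.conj_mul', Complex.ofReal_pow]
  refine Complex.ofReal_injective ?_
  have h1 : ((‖B‖ ^ 2 : ℝ) : ℂ) = inner ℂ B B := by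
    rw [inner_self_eq_norm_sq_to_K, Complex.ofReal_pow]
    rfl
  have h2 : inner ℂ B B = ∫ p, ((H : ℂ)⁻¹) ^ 2 * ∑ h ∈ Finset.range H, ∑ j ∈ Finset.range H,
      star (Φ h p) * Φ j p ∂(μ.prod μ) := by
    rw [L2.inner_def]
    refine integral_congr_ae ?_
    filter_upwards [hB] with p hp
    have e3 : B p = (H : ℂ)⁻¹ * ∑ k ∈ Finset.range H, Φ k p := by
      simp [hp, average, hΦ, Prod.map_iterate]
    rw [RCLike.inner_apply, e3, map_mul, map_sum, ← Finset.sum_mul_sum]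
    simp only [map_inv₀, map_natCast, Complex.star_def]
    ring
  rw [h1, h2, integral_const_mul, integral_finsetSum _ fun h _ =>
    integrable_finsetSum _ fun j _ => hint h j]
  simp only [integral_finsetSum _ fun j _ => hint _ j, hval]
  push_cast
  rfl

/-- If `f` is orthogonal to all functions with almost uniformly Cauchy averages, then its
autocorrelations vanish on average. -/
lemma tendsto_autocorrelation (hT : MeasurePreserving T μ μ) (f : Lp ℂ 2 μ)
    (hf : ∀ v : Lp ℂ 2 μ, AlmostUniformCauchy μ T v → inner ℂ f v = 0) :
    Tendsto (fun H : ℕ => ((H : ℝ)⁻¹) ^ 2 * ∑ h ∈ Finset.range H, ∑ j ∈ Finset.range H,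
      ‖∫ x, f (T^[h] x) * star (f (T^[j] x)) ∂μ‖ ^ 2) atTop (𝓝 0) := by
  have hTT : MeasurePreserving (Prod.map T T) (μ.prod μ) (μ.prod μ) := hT.prod hT
  have hF := memLp_mul_star_prod (Lp.memLp f)
  obtain ⟨K, hK, hinner, hlim⟩ :=
    exists_tendsto_birkhoffAverage_weightedKoopman hTT (z := 1) (by simp) hF.toLp
  have hinv : K ∘ Prod.map T T =ᵐ[μ.prod μ] K := by
    have := coeFn_weightedKoopman hTT 1 K
    rw [hK] at this
    filter_upwards [this] with x hx
    simpa using hx.symm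
  have hg := memLp_integral_kernel (Lp.memLp K) f
  have hauc := (almostUniformCauchy_integral_kernel hT (Lp.stronglyMeasurable K) (Lp.memLp K) hinv
    f).congr hT hg.coeFn_toLp.symm
  have h0 := hf _ hauc
  set F := hF.toLp with hFdef
  set g := hg.toLp with hgdef
  -- Fubini moves the pairing from the product space to `Ω`, where orthogonality of `f` to `g`
  -- applies.
  have h1 : inner ℂ F K = inner ℂ f g := by
    rw [L2.inner_def, L2.inner_def]
    have hint : Integrable (fun p : Ω × Ω => star (f p.1 * star (f p.2)) * K p) (μ.prod μ) :=
      hF.star.integrable_mul (Lp.memLp K)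
    calc ∫ p, inner ℂ (F p) (K p) ∂(μ.prod μ)
        = ∫ p, star (f p.1 * star (f p.2)) * K p ∂(μ.prod μ) := by
          refine integral_congr_ae ?_
          filter_upwards [hF.coeFn_toLp] with p hp
          rw [hp]
          simp [mul_comm]
      _ = ∫ x, ∫ y, star (f x * star (f y)) * K (x, y) ∂μ ∂μ := integral_prod _ hint
      _ = ∫ x, inner ℂ (f x) (g x) ∂μ := by
          refine integral_congr_ae ?_
          filter_upwards [hg.coeFn_toLp] with x hx
          rw [hx, RCLike.inner_apply, mul_comm, ← integral_const_mul]
          congr 1 with y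
          simp
          ring
  have hK0 : K = 0 := by
    have h2 := hinner K hK
    rw [← inner_conj_symm K F, h1, h0, map_zero] at h2
    exact inner_self_eq_zero.1 h2
  rw [hK0] at hlim
  have h3 := (tendsto_zero_iff_norm_tendsto_zero.1 hlim).pow 2
  rw [zero_pow two_ne_zero] at h3
  refine h3.congr fun H => norm_sq_of_ae_eq_average_mul_star hT (Lp.memLp f) H _ ?_
  filter_upwards [coeFn_birkhoffAverage_weightedKoopman hTT 1 H F,
    ae_average_congr hTT hF.coeFn_toLp] with p h1 h2
  rw [h1, h2]

end Kernel

/-! ### Van der Corput's inequality along orbits. -/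

section VanDerCorput

lemma norm_sum_sub_sum_shift_le (b : ℕ → ℂ) {h H : ℕ} (hH : h ≤ H) (N : ℕ) :
    ‖∑ k ∈ Finset.range N, b k - ∑ k ∈ Finset.range N, b (k + h)‖ ≤
      ∑ k ∈ Finset.range H, (‖b k‖ + ‖b (N + k)‖) := by
  have h1 := Finset.sum_range_add b N h
  have h2 := Finset.sum_range_add b h N
  rw [add_comm h N, h1] at h2
  have h3 : ∑ k ∈ Finset.range N, b k - ∑ k ∈ Finset.range N, b (k + h) =
      ∑ k ∈ Finset.range h, (b k - b (N + k)) := by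
    rw [Finset.sum_sub_distrib]
    simp only [add_comm _ h]
    linear_combination h2
  rw [h3]
  calc _ ≤ ∑ k ∈ Finset.range h, (‖b k‖ + ‖b (N + k)‖) :=
        (norm_sum_le _ _).trans (Finset.sum_le_sum fun k _ => norm_sub_le _ _)
    _ ≤ _ := Finset.sum_le_sum_of_subset_of_nonneg (Finset.range_mono hH)
        fun k _ _ => by positivity

lemma sum_norm_sq_block_le (b : ℕ → ℂ) (H N : ℕ) :
    ∑ k ∈ Finset.range N, ‖∑ h ∈ Finset.range H, b (k + h)‖ ^ 2 ≤
      ∑ h ∈ Finset.range H, ∑ j ∈ Finset.range H,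
        ‖∑ k ∈ Finset.range N, b (k + h) * star (b (k + j))‖ := by
  have h1 : ((∑ k ∈ Finset.range N, ‖∑ h ∈ Finset.range H, b (k + h)‖ ^ 2 : ℝ) : ℂ) =
      ∑ h ∈ Finset.range H, ∑ j ∈ Finset.range H,
        ∑ k ∈ Finset.range N, b (k + h) * star (b (k + j)) := by
    push_cast
    calc _ = ∑ k ∈ Finset.range N, ∑ h ∈ Finset.range H, ∑ j ∈ Finset.range H,
          b (k + h) * star (b (k + j)) := by
          refine Finset.sum_congr rfl fun k _ => ?_
          rw [← Complex.mul_conj', map_sum, Finset.sum_mul_sum]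
          rfl
      _ = _ := by
          rw [Finset.sum_comm]
          exact Finset.sum_congr rfl fun h _ => Finset.sum_comm
  have h2 : (0 : ℝ) ≤ ∑ k ∈ Finset.range N, ‖∑ h ∈ Finset.range H, b (k + h)‖ ^ 2 :=
    Finset.sum_nonneg fun k _ => by positivity
  rw [← abs_of_nonneg h2, ← Real.norm_eq_abs, ← Complex.norm_real, h1]
  exact (norm_sum_le _ _).trans (Finset.sum_le_sum fun h _ => norm_sum_le _ _)

/-- A form of van der Corput's inequality. -/
lemma norm_average_le_sqrt_add (b : ℕ → ℂ) {H N : ℕ} (hH : 0 < H) (hN : 0 < N) :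
    (N : ℝ)⁻¹ * ‖∑ k ∈ Finset.range N, b k‖ ≤
      √(((H : ℝ)⁻¹) ^ 2 * ∑ h ∈ Finset.range H, ∑ j ∈ Finset.range H,
        (N : ℝ)⁻¹ * ‖∑ k ∈ Finset.range N, b (k + h) * star (b (k + j))‖) +
      (N : ℝ)⁻¹ * ∑ k ∈ Finset.range H, (‖b k‖ + ‖b (N + k)‖) := by
  have hH' : (0 : ℝ) < H := by exact_mod_cast hH
  have hN' : (0 : ℝ) < N := by exact_mod_cast hN
  set R := ∑ k ∈ Finset.range H, (‖b k‖ + ‖b (N + k)‖) with hR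
  set Q := ∑ h ∈ Finset.range H, ∑ j ∈ Finset.range H,
    ‖∑ k ∈ Finset.range N, b (k + h) * star (b (k + j))‖ with hQ
  set X := ‖∑ k ∈ Finset.range N, ∑ h ∈ Finset.range H, b (k + h)‖ with hX
  have h1 : X ^ 2 ≤ N * Q := by
    calc X ^ 2 ≤ (∑ k ∈ Finset.range N, ‖∑ h ∈ Finset.range H, b (k + h)‖) ^ 2 :=
          pow_le_pow_left₀ (norm_nonneg _) (norm_sum_le _ _) 2
      _ ≤ N * ∑ k ∈ Finset.range N, ‖∑ h ∈ Finset.range H, b (k + h)‖ ^ 2 := by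
          simpa using sq_sum_le_card_mul_sum_sq (s := Finset.range N)
            (f := fun k => ‖∑ h ∈ Finset.range H, b (k + h)‖)
      _ ≤ _ := mul_le_mul_of_nonneg_left (sum_norm_sq_block_le b H N) hN'.le
  -- Each of `H` copies of the sum is replaced by a shift of itself, at a cost of at most `R`;
  -- together the shifts form block sums of length `H`.
  have h2 : H * ‖∑ k ∈ Finset.range N, b k‖ ≤ H * R + X := by
    have e1 : (H : ℂ) * ∑ k ∈ Finset.range N, b k = ∑ h ∈ Finset.range H,
        (∑ k ∈ Finset.range N, b k - ∑ k ∈ Finset.range N, b (k + h)) +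
        ∑ k ∈ Finset.range N, ∑ h ∈ Finset.range H, b (k + h) := by
      rw [Finset.sum_sub_distrib, Finset.sum_comm (s := Finset.range N)]
      simp
    have e2 : (H : ℝ) * ‖∑ k ∈ Finset.range N, b k‖ = ‖(H : ℂ) * ∑ k ∈ Finset.range N, b k‖ := by
      simp
    rw [e2, e1]
    refine (norm_add_le _ _).trans (add_le_add ((norm_sum_le _ _).trans ?_) le_rfl)
    refine (Finset.sum_le_sum fun h hh => norm_sum_sub_sum_shift_le b
      (Finset.mem_range.1 hh).le N).trans (le_of_eq ?_)
    simp [hR]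
  have h3 : X / (H * N) ≤ √(((H : ℝ)⁻¹) ^ 2 * ∑ h ∈ Finset.range H, ∑ j ∈ Finset.range H,
        (N : ℝ)⁻¹ * ‖∑ k ∈ Finset.range N, b (k + h) * star (b (k + j))‖) := by
    refine Real.le_sqrt_of_sq_le ?_
    simp only [← Finset.mul_sum]
    rw [← hQ, div_pow, div_le_iff₀ (by positivity)]
    refine h1.trans (le_of_eq ?_)
    field_simp
  refine le_trans ?_ (add_le_add h3 le_rfl)
  rw [inv_mul_le_iff₀ hN']
  refine le_of_mul_le_mul_left (h2.trans (le_of_eq ?_)) hH'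
  field_simp
  ring

variable {Ω : Type*} {T : Ω → Ω}

/-- The bound of van der Corput's inequality for an orbit; it does not depend on the weight. -/
noncomputable def corputBound (T : Ω → Ω) (f : Ω → ℂ) (H N : ℕ) (x : Ω) : ℝ :=
  √(((H : ℝ)⁻¹) ^ 2 * ∑ h ∈ Finset.range H, ∑ j ∈ Finset.range H,
      ‖average T 1 N (fun y => f (T^[h] y) * star (f (T^[j] y))) x‖) +
    ∑ k ∈ Finset.range H, ((N : ℝ)⁻¹ * ‖f (T^[k] x)‖ + (N : ℝ)⁻¹ * ‖f (T^[N] (T^[k] x))‖)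

/-- In the correlations the weight enters as `z ^ (k + h) * conj (z ^ (k + j)) = z ^ h * conj (z ^
j)`, which is free of `k` and of modulus one. -/
lemma norm_average_le_corputBound (f : Ω → ℂ) {z : ℂ} (hz : ‖z‖ = 1) {H N : ℕ} (hH : 0 < H)
    (hN : 0 < N) (x : Ω) : ‖average T z N f x‖ ≤ corputBound T f H N x := by
  have h := norm_average_le_sqrt_add (fun k => z ^ k * f (T^[k] x)) hH hN
  have e1 : ‖average T z N f x‖ = (N : ℝ)⁻¹ * ‖∑ k ∈ Finset.range N, z ^ k * f (T^[k] x)‖ := by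
    rw [average, norm_mul, one_div, norm_inv, Complex.norm_natCast]
  have e2 : ∀ h j, (N : ℝ)⁻¹ * ‖∑ k ∈ Finset.range N, z ^ (k + h) * f (T^[k + h] x) *
      star (z ^ (k + j) * f (T^[k + j] x))‖ =
      ‖average T 1 N (fun y => f (T^[h] y) * star (f (T^[j] y))) x‖ := by
    intro h j
    have e3 : ∀ k, z ^ (k + h) * f (T^[k + h] x) * star (z ^ (k + j) * f (T^[k + j] x)) =
        z ^ h * star (z ^ j) * (f (T^[h] (T^[k] x)) * star (f (T^[j] (T^[k] x)))) := by
      intro k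
      have hzk : z ^ k * star (z ^ k) = 1 := by
        rw [Complex.star_def, Complex.mul_conj', norm_pow, hz]
        simp
      rw [add_comm k h, add_comm k j, Function.iterate_add_apply, Function.iterate_add_apply,
        pow_add, pow_add, star_mul, star_mul]
      linear_combination z ^ h * star (z ^ j) * (f (T^[h] (T^[k] x)) *
        star (f (T^[j] (T^[k] x)))) * hzk
    simp only [e3, ← Finset.mul_sum]
    rw [average, norm_mul, norm_mul, norm_mul, norm_star, norm_pow, norm_pow, hz, one_div, norm_inv,
      Complex.norm_natCast]
    simp
  simp only [e2] at h
  rw [e1]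
  refine h.trans (le_of_eq ?_)
  rw [corputBound, add_right_inj, Finset.mul_sum]
  refine Finset.sum_congr rfl fun k _ => ?_
  rw [norm_mul, norm_mul, norm_pow, norm_pow, hz, one_pow, one_pow, one_mul, one_mul, mul_add,
    Function.iterate_add_apply]

/-- The term `f (T^[n] x) / n` is a difference of consecutive averages up to the factor `1 + 1 / n`.
This disposes of the boundary terms in `corputBound`. -/
lemma tendsto_inv_mul_norm_iterate {f : Ω → ℂ} {x : Ω} {c : ℂ}
    (h : Tendsto (fun n => average T 1 n f x) atTop (𝓝 c)) :
    Tendsto (fun n : ℕ => (n : ℝ)⁻¹ * ‖f (T^[n] x)‖) atTop (𝓝 0) := by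
  have h1 : Tendsto (fun n : ℕ => (1 + (n : ℂ)⁻¹) * average T 1 (n + 1) f x - average T 1 n f x)
      atTop (𝓝 0) := by
    have h2 : Tendsto (fun n : ℕ => (n : ℂ)⁻¹) atTop (𝓝 0) := tendsto_inv_atTop_nhds_zero_nat
    simpa using ((h2.const_add 1).mul (h.comp (tendsto_add_atTop_nat 1))).sub h
  refine (tendsto_zero_iff_norm_tendsto_zero.1 h1).congr' ?_
  filter_upwards [eventually_gt_atTop 0] with n hn
  have hn' : (n : ℂ) ≠ 0 := by exact_mod_cast hn.ne'
  have hn1 : (n : ℂ) + 1 ≠ 0 := by exact_mod_cast n.succ_ne_zero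
  have e : (1 + (n : ℂ)⁻¹) * average T 1 (n + 1) f x - average T 1 n f x =
      (n : ℂ)⁻¹ * f (T^[n] x) := by
    simp only [average, Finset.sum_range_succ, one_pow, one_mul]
    push_cast
    field_simp
    ring
  rw [e, norm_mul, norm_inv, Complex.norm_natCast]

end VanDerCorput

/-! ### Egorov's theorem and density in `L²`. -/

section Main

variable {Ω : Type*} [MeasurableSpace Ω] {μ : Measure Ω} {T : Ω → Ω}

lemma measurable_average (hT : Measurable T) {f : Ω → ℂ} (hf : Measurable f) (z : ℂ) (n : ℕ) :
    Measurable (average T z n f) :=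
  (Finset.measurable_sum _ fun k _ => (hf.comp (hT.iterate k)).const_mul _).const_mul _

lemma measurable_corputBound (hT : Measurable T) {f : Ω → ℂ} (hf : Measurable f) (H N : ℕ) :
    Measurable (corputBound T f H N) := by
  have hk : ∀ k, Measurable fun x => f (T^[k] x) := fun k => hf.comp (hT.iterate k)
  refine Measurable.add ?_ ?_
  · refine Measurable.sqrt (Measurable.const_mul ?_ _)
    exact Finset.measurable_fun_sum _ fun h _ => Finset.measurable_fun_sum _ fun j _ =>
      (measurable_average hT ((hk h).mul (continuous_star.measurable.comp (hk j))) 1 N).norm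
  · exact Finset.measurable_fun_sum _ fun k _ => ((hk k).norm.const_mul _).add
      (((hk N).comp (hT.iterate k)).norm.const_mul _)

lemma ae_tendsto_corputBound [IsFiniteMeasure μ] (hT : Ergodic T μ) {f : Ω → ℂ}
    (hf : MemLp f 2 μ) (H : ℕ) :
    ∀ᵐ x ∂μ, Tendsto (fun N => corputBound T f H N x) atTop
      (𝓝 √(((H : ℝ)⁻¹) ^ 2 * ∑ h ∈ Finset.range H, ∑ j ∈ Finset.range H,
        ‖⨍ y, f (T^[h] y) * star (f (T^[j] y)) ∂μ‖)) := by
  have hfk : ∀ k, MemLp (fun x => f (T^[k] x)) 2 μ := fun k =>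
    hf.comp_measurePreserving (hT.toMeasurePreserving.iterate k)
  have h1 : ∀ᵐ x ∂μ, ∀ h j, Tendsto
      (fun N => average T 1 N (fun y => f (T^[h] y) * star (f (T^[j] y))) x) atTop
      (𝓝 (⨍ y, f (T^[h] y) * star (f (T^[j] y)) ∂μ)) :=
    ae_all_iff.2 fun h => ae_all_iff.2 fun j =>
      ae_tendsto_average hT ((hfk h).integrable_mul (hfk j).star)
  have h2 : ∀ᵐ x ∂μ, ∀ k, Tendsto (fun N => average T 1 N f (T^[k] x)) atTop (𝓝 (⨍ y, f y ∂μ)) :=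
    ae_all_iff.2 fun k => (hT.toMeasurePreserving.iterate k).quasiMeasurePreserving.ae
      (ae_tendsto_average hT (hf.integrable one_le_two))
  filter_upwards [h1, h2] with x hx1 hx2
  have h3 : Tendsto (fun N : ℕ => ∑ k ∈ Finset.range H,
      ((N : ℝ)⁻¹ * ‖f (T^[k] x)‖ + (N : ℝ)⁻¹ * ‖f (T^[N] (T^[k] x))‖)) atTop
      (𝓝 (∑ _k ∈ Finset.range H, (0 : ℝ))) := by
    refine tendsto_finsetSum _ fun k _ => ?_
    have h4 : Tendsto (fun N : ℕ => (N : ℝ)⁻¹) atTop (𝓝 0) := tendsto_inv_atTop_nhds_zero_nat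
    simpa using (h4.mul_const ‖f (T^[k] x)‖).add (tendsto_inv_mul_norm_iterate (hx2 k))
  have h5 := (Tendsto.const_mul (((H : ℝ)⁻¹) ^ 2) (tendsto_finsetSum (Finset.range H) fun h _ =>
    tendsto_finsetSum (Finset.range H) fun j _ => (hx1 h j).norm)).sqrt
  rw [Finset.sum_const_zero] at h3
  have h6 := h5.add h3
  rwa [add_zero] at h6

lemma sq_sum_sum_range_le (q : ℕ → ℕ → ℝ) (H : ℕ) :
    (∑ h ∈ Finset.range H, ∑ j ∈ Finset.range H, q h j) ^ 2 ≤
      (H : ℝ) ^ 2 * ∑ h ∈ Finset.range H, ∑ j ∈ Finset.range H, q h j ^ 2 := by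
  have := sq_sum_le_card_mul_sum_sq (s := Finset.range H ×ˢ Finset.range H)
    (f := fun p : ℕ × ℕ => q p.1 p.2)
  rw [Finset.sum_product, Finset.sum_product] at this
  simpa [sq] using this

/-- A function whose autocorrelations vanish on average has weighted averages that converge to zero
almost uniformly, uniformly in the weight. -/
lemma almostUniformCauchy_of_tendsto_autocorrelation [IsFiniteMeasure μ] (hT : Ergodic T μ)
    {f : Ω → ℂ} (hfm : Measurable f) (hf : MemLp f 2 μ)
    (h : Tendsto (fun H : ℕ => ((H : ℝ)⁻¹) ^ 2 * ∑ h ∈ Finset.range H, ∑ j ∈ Finset.range H,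
      ‖∫ x, f (T^[h] x) * star (f (T^[j] x)) ∂μ‖ ^ 2) atTop (𝓝 0)) :
    AlmostUniformCauchy μ T f := by
  intro ε hε η hη
  have h' := h.const_mul (((μ.real Set.univ)⁻¹) ^ 2)
  rw [mul_zero] at h'
  -- Fourth power: `L` is the square root of a mean of moduli, and the square of that mean is at
  -- most the mean of their squares.
  obtain ⟨H, hHle, hH⟩ := ((h'.eventually (ge_mem_nhds (show 0 < (η / 4) ^ 4 by positivity))).and
    (eventually_gt_atTop 0)).exists
  have hH' : (0 : ℝ) < H := by exact_mod_cast hH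
  set L := √(((H : ℝ)⁻¹) ^ 2 * ∑ h ∈ Finset.range H, ∑ j ∈ Finset.range H,
        ‖⨍ y, f (T^[h] y) * star (f (T^[j] y)) ∂μ‖) with hL
  have hLη : L ≤ η / 4 := by
    refine le_of_pow_le_pow_left₀ (n := 4) (by norm_num) (by positivity) (le_trans ?_ hHle)
    have e1 : L ^ 4 = (((H : ℝ)⁻¹) ^ 2 * ∑ h ∈ Finset.range H, ∑ j ∈ Finset.range H,
        ‖⨍ y, f (T^[h] y) * star (f (T^[j] y)) ∂μ‖) ^ 2 := by
      rw [show (4 : ℕ) = 2 * 2 from rfl, pow_mul, hL, Real.sq_sqrt (by positivity)]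
    rw [e1, mul_pow]
    refine (mul_le_mul_of_nonneg_left (sq_sum_sum_range_le _ H) (by positivity)).trans
      (le_of_eq ?_)
    simp only [MeasureTheory.average_eq, norm_smul, mul_pow, ← Finset.mul_sum, norm_inv,
      Real.norm_of_nonneg measureReal_nonneg]
    field_simp
  -- Egorov's theorem is applied to the bound, which does not involve `z`, so here both the set and
  -- `N` serve all weights.
  obtain ⟨t, ht, hμt, hunif⟩ := tendstoUniformlyOn_of_ae_tendsto' (μ := μ)
    (f := fun N => corputBound T f H N) (g := fun _ => L)
    (fun N => (measurable_corputBound hT.measurable hfm H N).stronglyMeasurable)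
    stronglyMeasurable_const (ae_tendsto_corputBound hT hf H) hε
  obtain ⟨N, hN⟩ := eventually_atTop.1
    ((Metric.tendstoUniformlyOn_iff.1 hunif (η / 4) (by positivity)).and (eventually_gt_atTop 0))
  refine ⟨tᶜ, ht.compl, by rwa [compl_compl], fun z hz => ⟨N, fun m hm n hn x hx => ?_⟩⟩
  have hb : ∀ n ≥ N, ‖average T z n f x‖ ≤ η / 2 := by
    intro n hn
    have h1 := (hN n hn).1 x hx
    rw [dist_comm, Real.dist_eq] at h1
    have h2 := norm_average_le_corputBound (T := T) f hz hH (hN n hn).2 x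
    linarith [(abs_lt.1 h1).2]
  exact (norm_sub_le _ _).trans (by linarith [hb m hm, hb n hn])

lemma AlmostUniformCauchy.zero : AlmostUniformCauchy μ T (0 : Ω → ℂ) := fun ε _ η hη =>
  ⟨Set.univ, MeasurableSet.univ, by simp, fun z _ => ⟨0, fun m _ n _ x _ => by
    simpa [average] using hη.le⟩⟩

/-- The subspace of `L²` of functions with almost uniformly Cauchy weighted averages. -/
def almostUniformCauchySubmodule (hT : MeasurePreserving T μ μ) : Submodule ℂ (Lp ℂ 2 μ) where
  carrier := {v | AlmostUniformCauchy μ T v}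
  add_mem' hu hv := (hu.add hv).congr hT (Lp.coeFn_add _ _).symm
  zero_mem' := AlmostUniformCauchy.zero.congr hT (Lp.coeFn_zero ℂ 2 μ).symm
  smul_mem' c _ hv := (hv.const_smul c).congr hT (Lp.coeFn_smul _ _).symm

/-- A vector orthogonal to the subspace also belongs to it, hence is zero. The subspace is thus
dense in `L²`, and closedness in the weaker `L¹` norm gives everything. -/
lemma almostUniformCauchy_Lp [IsFiniteMeasure μ] (hT : Ergodic T μ) (v : Lp ℂ 2 μ) :
    AlmostUniformCauchy μ T v := by
  have hT' := hT.toMeasurePreserving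
  set V := almostUniformCauchySubmodule hT' with hV
  have hperp : Vᗮ = ⊥ := by
    rw [Submodule.eq_bot_iff]
    intro f hf
    have hfV : f ∈ V := almostUniformCauchy_of_tendsto_autocorrelation hT
      (Lp.stronglyMeasurable f).measurable (Lp.memLp f) (tendsto_autocorrelation hT' f
        fun v hv => Submodule.inner_left_of_mem_orthogonal (K := V) hv hf)
    exact inner_self_eq_zero.1 (Submodule.inner_right_of_mem_orthogonal hfV hf)
  have hv : v ∈ V.topologicalClosure := by
    rw [Submodule.topologicalClosure_eq_top_iff.2 hperp]
    exact Submodule.mem_top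
  refine AlmostUniformCauchy.of_approx hT' fun δ hδ => ?_
  obtain ⟨g, hg, hvg⟩ := Metric.mem_closure_iff.1 hv (δ / (√(μ.real Set.univ) + 1)) (by positivity)
  refine ⟨g, hg, ((Lp.memLp v).sub (Lp.memLp g)).integrable one_le_two, ?_⟩
  rw [dist_eq_norm, lt_div_iff₀ (by positivity)] at hvg
  have h1 := integral_norm_le_of_Lp (v - g)
  rw [integral_congr_ae ((Lp.coeFn_sub v g).mono fun x hx => congrArg norm hx)] at h1
  nlinarith [norm_nonneg (v - g)]

end Main
end WienerWintner

theorem theorem2p1 {Ω : Type*} [MeasurableSpace Ω] (μ : Measure Ω) [IsFiniteMeasure μ]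
    (T : Ω → Ω) (hT : Ergodic T μ) :
    {f : Ω → ℂ | MemLp f 1 μ} ⊆ WienerWintner.auWW μ T := by
  intro f hf
  have hT' := hT.toMeasurePreserving
  -- Closedness in `L¹` is used once more, now with approximants in `L²`.
  refine (WienerWintner.AlmostUniformCauchy.of_approx hT' fun δ hδ => ?_).mem_auWW
    hf.aestronglyMeasurable
  obtain ⟨s, -, hs2, hs1, hδs⟩ :=
    WienerWintner.exists_bounded_integral_norm_sub_le (memLp_one_iff_integrable.1 hf) hδ
  exact ⟨s, (WienerWintner.almostUniformCauchy_Lp hT hs2.toLp).congr hT' hs2.coeFn_toLp,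
    (memLp_one_iff_integrable.1 hf).sub hs1, hδs⟩
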